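/- Let $\mathcal{H}$ be a complex Hilbert space with inner product linear in the second variable, and write $|x\rangle\langle y|$ for the operator $z\mapsto\langle y,z\rangle x$. Let $(T_t)_{t\ge 0}$ be a quantum Markov semigroup on $\mathcal{B}(\mathcal{H})$, that is, a semigroup ($T_0=\mathrm{id}$, $T_{t+s}=T_tT_s$) of $\sigma$-weakly continuous, completely positive linear maps with $T_t(1)=1$ such that $t\mapsto T_t(A)$ is $\sigma$-weakly continuous for every $A$. Let $L(A)=\lim_{t\to 0^+}\frac1t(T_tA-A)$ ($\sigma$-weak limit) be its generator, with domain $D(L)$ the set of all $A$ for which this limit exists, and let $\mathcal{A}$ be its domain algebra, i.e. the largest $*$-subalgebra of $\mathcal{B}(\mathcal{H})$ contained in $D(L)$; it exists and equals $\{A\in D(L): A^*A,\ AA^*\in D(L)\}$. Let $T\neq 0$ be a positive finite rank operator in $D(L)$ and let $h$ be an associate vector for $T$: there are orthonormal vectors $k_1',\dots,k_m'$ and numbers $t_1',\dots,t_m'>0$ with $T=\sum_{s=1}^m t_s'|k_s'\rangle\langle k_s'|$ such that, with $t=\sum_s t_s'$ and $k_s=\sqrt t\,k_s'$, one has $h=\sum_{s=1}^m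 \|k_s\|^{-2}k_s$. Assume that $|Th\rangle\langle Th|\in D(L)$. Let $U$ be the linear subspace $U=\{x\in\mathcal{H}: |x\rangle\langle Th|\in\mathcal{A}\}$ and let $G:U\to\mathcal{H}$ be the linear operator $$G(u)=L(|u\rangle\langle Th|)h-\tfrac12\langle h,L(T)h\rangle u .$$ Then there is a linear map $\phi$ from $\mathcal{A}$ to the sesquilinear forms on $U\times U$ (conjugate linear in the first variable) which is $U$-completely positive, i.e. $\sum_{i,j=1}^k\phi(A_{ij})(u_i,u_j)\ge 0$ for all $k\in\mathbb{N}$, all $u_1,\dots,u_k\in U$ and all $k\times k$ matrices $(A_{ij})$ with entries in $\mathcal{A}$ that are positive as operators on $\mathcal{H}^k$, such that $$\langle u,L(A)v\rangle=\phi(A)(u,v)+\langle u,GAv\rangle+\langle GA^*u,v\rangle$$ for all $A\in\mathcal{A}$ and $u,v\in U$ (here $Av, A^*u\in U$). -/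

import Mathlib

open Filter Topology
open scoped NNReal InnerProductSpace ComplexOrder CStarAlgebra

noncomputable section

set_option linter.unusedSectionVars false

namespace QMS

variable {H : Type*} [NormedAddCommGroup H] [InnerProductSpace ℂ H] [CompleteSpace H]

/-- A sequence of vectors whose norms are square summable. -/
def SqSummable (x : ℕ → H) : Prop := Summable fun n => ‖x n‖ ^ 2

/-- The functional `A ↦ ∑ₙ ⟪xₙ, A yₙ⟫`. For square summable `x`, `y` this is `A ↦ tr (A S)` with
`S = ∑ₙ |yₙ⟩⟨xₙ|`, and every trace class operator `S` has this form. -/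
def traceFunctional (x y : ℕ → H) (A : H →L[ℂ] H) : ℂ := ∑' n, ⟪x n, A (y n)⟫_ℂ

variable (H) in
/-- The `σ`-weak topology on the bounded operators on `H`: the coarsest topology that makes all the
functionals `A ↦ ∑ₙ ⟪xₙ, A yₙ⟫` with `∑ₙ ‖xₙ‖² < ∞` and `∑ₙ ‖yₙ‖² < ∞` continuous. -/
@[reducible] def sigmaWeak : TopologicalSpace (H →L[ℂ] H) :=
  ⨅ (x : ℕ → H) (y : ℕ → H) (_ : SqSummable x) (_ : SqSummable y),
    TopologicalSpace.induced (traceFunctional x y) inferInstance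

/-- Convergence in the `σ`-weak topology. -/
def SigmaWeakTendsto {α : Type*} (f : α → H →L[ℂ] H) (l : Filter α) (B : H →L[ℂ] H) : Prop :=
  Tendsto f l (@nhds _ (sigmaWeak H) B)

theorem summable_traceFunctional {x y : ℕ → H} (hx : SqSummable x) (hy : SqSummable y)
    (A : H →L[ℂ] H) : Summable fun n => ⟪x n, A (y n)⟫_ℂ := by
  refine Summable.of_norm_bounded (g := fun n => ‖A‖ * (‖x n‖ ^ 2 + ‖y n‖ ^ 2))
    ((hx.add hy).mul_left _) fun n => ?_
  have h1 := norm_inner_le_norm (𝕜 := ℂ) (x n) (A (y n))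
  have h2 := mul_le_mul_of_nonneg_left (A.le_opNorm (y n)) (norm_nonneg (x n))
  nlinarith [mul_nonneg (norm_nonneg A) (sq_nonneg (‖x n‖ - ‖y n‖)),
    mul_nonneg (norm_nonneg A) (sq_nonneg (‖x n‖)), mul_nonneg (norm_nonneg A) (sq_nonneg (‖y n‖))]

theorem traceFunctional_add {x y : ℕ → H} (hx : SqSummable x) (hy : SqSummable y)
    (A B : H →L[ℂ] H) :
    traceFunctional x y (A + B) = traceFunctional x y A + traceFunctional x y B := by
  simp only [traceFunctional, add_apply, inner_add_right]
  exact (summable_traceFunctional hx hy A).tsum_add (summable_traceFunctional hx hy B)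

theorem traceFunctional_smul (x y : ℕ → H) (c : ℂ) (A : H →L[ℂ] H) :
    traceFunctional x y (c • A) = c * traceFunctional x y A := by
  simp only [traceFunctional, smul_apply, inner_smul_right]
  exact tsum_mul_left

theorem sigmaWeakTendsto_iff {α : Type*} {f : α → H →L[ℂ] H} {l : Filter α} {B : H →L[ℂ] H} :
    SigmaWeakTendsto f l B ↔ ∀ x y : ℕ → H, SqSummable x → SqSummable y →
      Tendsto (fun a => traceFunctional x y (f a)) l (𝓝 (traceFunctional x y B)) := by
  unfold SigmaWeakTendsto sigmaWeak
  rw [nhds_iInf]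
  simp only [tendsto_iInf]
  refine forall_congr' fun x => ?_
  rw [nhds_iInf]
  simp only [tendsto_iInf]
  refine forall_congr' fun y => ?_
  rw [nhds_iInf]
  simp only [tendsto_iInf]
  refine forall_congr' fun hx => ?_
  rw [nhds_iInf]
  simp only [tendsto_iInf]
  refine forall_congr' fun hy => ?_
  rw [nhds_induced, tendsto_comap_iff]
  rfl

theorem SigmaWeakTendsto.add {α : Type*} {f g : α → H →L[ℂ] H} {l : Filter α} {B C : H →L[ℂ] H}
    (hf : SigmaWeakTendsto f l B) (hg : SigmaWeakTendsto g l C) :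
    SigmaWeakTendsto (fun a => f a + g a) l (B + C) := by
  rw [sigmaWeakTendsto_iff] at *
  intro x y hx hy
  simpa only [traceFunctional_add hx hy] using (hf x y hx hy).add (hg x y hx hy)

theorem SigmaWeakTendsto.smul {α : Type*} {f : α → H →L[ℂ] H} {l : Filter α} {B : H →L[ℂ] H}
    (c : ℂ) (hf : SigmaWeakTendsto f l B) : SigmaWeakTendsto (fun a => c • f a) l (c • B) := by
  rw [sigmaWeakTendsto_iff] at *
  intro x y hx hy
  simpa only [traceFunctional_smul] using (hf x y hx hy).const_mul c

theorem SigmaWeakTendsto.unique {α : Type*} {f : α → H →L[ℂ] H} {l : Filter α} [l.NeBot]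
    {B C : H →L[ℂ] H} (hB : SigmaWeakTendsto f l B) (hC : SigmaWeakTendsto f l C) : B = C := by
  rw [sigmaWeakTendsto_iff] at hB hC
  have hs : ∀ v : H, SqSummable (Pi.single 0 v : ℕ → H) := fun v =>
    summable_of_ne_finset_zero (s := {0}) fun n hn => by
      simp [Pi.single_eq_of_ne (Finset.notMem_singleton.mp hn)]
  have hsingle : ∀ (u v : H) (D : H →L[ℂ] H),
      traceFunctional (Pi.single 0 u : ℕ → H) (Pi.single 0 v) D = ⟪u, D v⟫_ℂ := fun u v D => by
    rw [traceFunctional, tsum_eq_single 0 fun n hn => by simp [Pi.single_eq_of_ne hn]]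
    simp
  refine ContinuousLinearMap.ext fun v => ext_inner_left ℂ fun u => ?_
  rw [← hsingle, ← hsingle]
  exact tendsto_nhds_unique (hB _ _ (hs u) (hs v)) (hC _ _ (hs u) (hs v))

variable (H) in
/-- A quantum Markov semigroup on the bounded operators on `H`: a one-parameter semigroup of
`σ`-weakly continuous, completely positive, unital linear maps with `σ`-weakly continuous
orbits. -/
structure QuantumMarkovSemigroup where
  /-- The maps `T_t`, for `t ≥ 0`. -/
  map : ℝ≥0 → ((H →L[ℂ] H) →CP (H →L[ℂ] H))
  sigmaWeak_continuous : ∀ t, Continuous[sigmaWeak H, sigmaWeak H] (map t)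
  map_zero : ∀ A, map 0 A = A
  map_add : ∀ t s A, map (t + s) A = map t (map s A)
  sigmaWeak_continuous_orbit : ∀ A, Continuous[inferInstance, sigmaWeak H] fun t => map t A
  map_one : ∀ t, map t 1 = 1

namespace QuantumMarkovSemigroup

variable (S : QuantumMarkovSemigroup H)

/-- `B` is the `σ`-weak limit of `(T_t A - A) / t` as `t → 0`, `t > 0`. -/
def HasGenerator (A B : H →L[ℂ] H) : Prop :=
  SigmaWeakTendsto (fun t : ℝ≥0 => ((t : ℝ) : ℂ)⁻¹ • (S.map t A - A)) (𝓝[>] 0) B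

theorem HasGenerator.add {A A' B B' : H →L[ℂ] H} (h : S.HasGenerator A B)
    (h' : S.HasGenerator A' B') : S.HasGenerator (A + A') (B + B') := by
  have := SigmaWeakTendsto.add h h'
  refine this.congr fun t => ?_
  rw [_root_.map_add, ← smul_add]
  congr 1
  abel

theorem HasGenerator.smul {A B : H →L[ℂ] H} (c : ℂ) (h : S.HasGenerator A B) :
    S.HasGenerator (c • A) (c • B) := by
  have := SigmaWeakTendsto.smul c h
  refine this.congr fun t => ?_
  rw [_root_.map_smul, ← smul_sub, smul_comm]

/-- The infinitesimal generator `L`, an unbounded operator with domain `D(L)`: `A ∈ D(L)` iff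
`(T_t A - A) / t` converges `σ`-weakly as `t → 0`, and `L(A)` is the limit. -/
def generator : (H →L[ℂ] H) →ₗ.[ℂ] (H →L[ℂ] H) where
  domain :=
    { carrier := {A | ∃ B, S.HasGenerator A B}
      add_mem' := fun ⟨B, hB⟩ ⟨C, hC⟩ => ⟨B + C, hB.add S hC⟩
      zero_mem' := ⟨0, sigmaWeakTendsto_iff.mpr fun x y _ _ => by
        simp [traceFunctional]⟩
      smul_mem' := fun c _ ⟨B, hB⟩ => ⟨c • B, hB.smul S c⟩ }
  toFun :=
    { toFun := fun A => Classical.choose A.2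
      map_add' := fun A A' => (Classical.choose_spec (A + A').2).unique
        ((Classical.choose_spec A.2).add S (Classical.choose_spec A'.2))
      map_smul' := fun c A => (Classical.choose_spec (c • A).2).unique
        ((Classical.choose_spec A.2).smul S c) }

theorem generator_spec (A : S.generator.domain) : S.HasGenerator A (S.generator A) :=
  Classical.choose_spec A.2

/-- The `*`-subalgebras of the bounded operators (closed or not, with unit or not) that are contained
in `D(L)`. -/
def starSubalgebrasInDomain : Set (NonUnitalStarSubalgebra ℂ (H →L[ℂ] H)) :=
  {B | ∀ A ∈ B, A ∈ S.generator.domain}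

/-- The domain algebra of `L`, the largest `*`-subalgebra of `D(L)`, as the supremum of all
`*`-subalgebras contained in `D(L)`. -/
def domainAlgebra : NonUnitalStarSubalgebra ℂ (H →L[ℂ] H) :=
  sSup S.starSubalgebrasInDomain

/-- The subspace of all `x` such that `|x⟩⟨w|` lies in the domain algebra. -/
def rankOneSubspace (w : H) : Submodule ℂ H where
  carrier := {x | InnerProductSpace.rankOne ℂ x w ∈ S.domainAlgebra}
  add_mem' {x y} hx hy := by
    simpa only [Set.mem_ofPred_eq, _root_.map_add, add_apply] using
      add_mem (show InnerProductSpace.rankOne ℂ x w ∈ S.domainAlgebra from hx)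
        (show InnerProductSpace.rankOne ℂ y w ∈ S.domainAlgebra from hy)
  zero_mem' := by
    simpa only [Set.mem_ofPred_eq, _root_.map_zero, zero_apply] using
      zero_mem S.domainAlgebra
  smul_mem' c x hx := by
    simpa only [Set.mem_ofPred_eq, _root_.map_smul, smul_apply] using
      SMulMemClass.smul_mem c (show InnerProductSpace.rankOne ℂ x w ∈ S.domainAlgebra from hx)

/-- The domain algebra leaves the subspace `{x | |x⟩⟨w| ∈ domain algebra}` invariant. -/
theorem apply_mem_rankOneSubspace {w : H} {A : H →L[ℂ] H} (hA : A ∈ S.domainAlgebra) {x : H}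
    (hx : x ∈ S.rankOneSubspace w) : A x ∈ S.rankOneSubspace w := by
  have h : A * InnerProductSpace.rankOne ℂ x w = InnerProductSpace.rankOne ℂ (A x) w := by
    ext v
    simp [InnerProductSpace.rankOne_apply]
  have h' : A * InnerProductSpace.rankOne ℂ x w ∈ S.domainAlgebra := mul_mem hA hx
  rw [h] at h'
  exact h'

/-- The domain algebra acting on the subspace `{x | |x⟩⟨w| ∈ domain algebra}`. -/
def act {w : H} (A : S.domainAlgebra) (x : S.rankOneSubspace w) : S.rankOneSubspace w :=
  ⟨(A : H →L[ℂ] H) x, S.apply_mem_rankOneSubspace A.2 x.2⟩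

end QuantumMarkovSemigroup

/-- `h` is an associate vector for `T`: there are a spectral decomposition
`T = ∑ₛ t'ₛ |k'ₛ⟩⟨k'ₛ|` with finitely many orthonormal vectors `k'ₛ` and numbers `t'ₛ > 0` such that,
with `t = ∑ₛ t'ₛ` and `kₛ = √t k'ₛ`, one has `h = ∑ₛ ‖kₛ‖⁻² kₛ`. -/
def IsAssociateVector (T : H →L[ℂ] H) (h : H) : Prop :=
  ∃ (m : ℕ) (k' : Fin m → H) (t' : Fin m → ℝ) (k : Fin m → H),
    Orthonormal ℂ k' ∧ (∀ s, 0 < t' s) ∧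
    T = ∑ s, (t' s : ℂ) • InnerProductSpace.rankOne ℂ (k' s) (k' s) ∧
    (∀ s, k s = (√(∑ r, t' r) : ℂ) • k' s) ∧
    h = ∑ s, ((‖k s‖ ^ 2)⁻¹ : ℂ) • k s

/-- `U`-complete positivity of a linear map from a space `V` of bounded operators on `H` to the
sesquilinear forms on `U × U` (conjugate linear in the first variable). -/
def IsUCompletelyPositive {V : Type*} [SetLike V (H →L[ℂ] H)] [AddSubmonoidClass V (H →L[ℂ] H)]
    [SMulMemClass V ℂ (H →L[ℂ] H)] (𝒜 : V) (U : Submodule ℂ H)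
    (φ : 𝒜 →ₗ[ℂ] (U →ₗ⋆[ℂ] U →ₗ[ℂ] ℂ)) : Prop :=
  ∀ (k : ℕ) (A : Fin k → Fin k → 𝒜),
    0 ≤ CStarMatrix.ofMatrix (Matrix.of fun i j => (A i j : H →L[ℂ] H)) →
    ∀ u : Fin k → U, 0 ≤ ∑ i, ∑ j, φ (A i j) (u i) (u j)

end QMS

end

noncomputable section

set_option linter.unusedSectionVars false

namespace QMS

/-! Write `w = T h`. The associate vector is normalised so that `⟨w, h⟩ = 1`
(`IsAssociateVector.inner_eq_one`). A positive matrix `(Aᵢⱼ)` over the domain algebra, bordered by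
`Aᵢⱼ|uⱼ⟩⟨w|`, its adjoint counterpart and `|w⟩⟨uᵢ|Aᵢⱼ|uⱼ⟩⟨w|`, stays positive, so complete
positivity of `T_t` can be tested on the vectors `uᵢ` and `-h`. At `t = 0` this test vanishes
because `⟨w, h⟩ = 1`; dividing by `t` gives the inequality `sum_inner_generator_nonneg` for `L`.
That inequality is the complete positivity of `φ`, except that it contains `⟨h, L(|w⟩⟨w|) h⟩` where
`G` demands `⟨h, L(T) h⟩`. Cauchy–Schwarz gives `|w⟩⟨w| ≤ T`, with equal expectations at `h`, so the
generator can only increase the expectation at `h` when passing to `T`. The replacement is thus in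
the favourable direction, and `φ` may be defined by the desired identity.

The domain algebra rests on two facts. `mem_domain_iff_isBigO`: `A ∈ D(L)` exactly when `‖T_t A - A‖
= O(t)`. Hence, for `A ∈ D(L)`, `A* A ∈ D(L)` exactly when the Schwarz defect `T_t(A* A) - T_t(A)*
T_t(A)` is `O(t)`. The defect is a positive quadratic form in `A` with a product estimate
(`schwarzDefect_mul_le`), which yields closure under sums and products. -/

/-- A continuous function whose right difference quotients converge along a fixed filter at every
point to a continuous function has that function as its right derivative. -/
theorem tendsto_slope_zero_of_tendsto_slope_filter {f g : ℝ → ℂ} (hf : Continuous f)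
    (hg : Continuous g) {U : Filter ℝ≥0} [U.NeBot] (hU : U ≤ 𝓝[>] 0)
    (h : ∀ r, 0 ≤ r → Tendsto (fun t : ℝ≥0 => ((t : ℝ) : ℂ)⁻¹ * (f (r + t) - f r)) U (𝓝 (g r))) :
    Tendsto (fun t : ℝ≥0 => ((t : ℝ) : ℂ)⁻¹ * (f t - f 0)) (𝓝[>] 0) (𝓝 (g 0)) := by
  have hG : ∀ r, HasDerivAt (fun r => ∫ u in (0 : ℝ)..r, g u) (g r) r := fun r =>
    intervalIntegral.integral_hasDerivAt_right (hg.intervalIntegrable _ _)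
      (hg.stronglyMeasurableAtFilter _ _) hg.continuousAt
  have hcoe : ∀ x : ℝ, Tendsto (fun t : ℝ≥0 => x + (t : ℝ)) (𝓝[>] 0) (𝓝[>] x) := fun x => by
    refine tendsto_nhdsWithin_iff.mpr ⟨?_, ?_⟩
    · have : Continuous fun t : ℝ≥0 => x + (t : ℝ) := by fun_prop
      simpa using (this.tendsto 0).mono_left nhdsWithin_le_nhds
    · filter_upwards [self_mem_nhdsWithin] with t ht
      have : (0 : ℝ) < t := ht
      simpa using this
  have hslope : ∀ x : ℝ, Tendsto (fun t : ℝ≥0 => ((t : ℝ) : ℂ)⁻¹ *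
      ((∫ u in (0 : ℝ)..(x + t), g u) - ∫ u in (0 : ℝ)..x, g u)) (𝓝[>] 0) (𝓝 (g x)) := fun x => by
    have h1 := (hasDerivWithinAt_iff_tendsto_slope' (lt_irrefl x)).mp
      ((hG x).hasDerivWithinAt (s := Set.Ioi x))
    refine (h1.comp (hcoe x)).congr fun t => ?_
    simp [slope_def_module]
  -- Subtracting the primitive of `g` reduces the claim to slopes that tend to zero along `U`.
  set F : ℝ → ℂ := fun r => f r - f 0 - ∫ u in (0 : ℝ)..r, g u with hF
  have hFc : Continuous F := by
    have : Continuous fun r => ∫ u in (0 : ℝ)..r, g u :=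
      continuous_iff_continuousAt.mpr fun r => (hG r).continuousAt
    fun_prop
  have hFU : ∀ x, 0 ≤ x →
      Tendsto (fun t : ℝ≥0 => ((t : ℝ) : ℂ)⁻¹ * (F (x + t) - F x)) U (𝓝 0) := fun x hx => by
    have := (h x hx).sub ((hslope x).mono_left hU)
    rw [sub_self] at this
    refine this.congr fun t => ?_
    simp only [hF]
    ring
  have key : ∀ s, 0 ≤ s → F s = 0 := fun s hs => by
    -- This mean value inequality needs small slopes only frequently near each point, so a filter
    -- finer than `𝓝[>] 0` is enough.
    have := image_le_of_liminf_slope_right_le_deriv_boundary (f := fun r => ‖F r‖)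
      (B := fun _ => 0) (B' := fun _ => 0) (a := 0) (b := s) hFc.norm.continuousOn (by simp [hF])
      continuousOn_const (fun x _ => hasDerivWithinAt_const _ _ _) ?_ ⟨hs, le_rfl⟩
    · exact norm_le_zero_iff.mp this
    · intro x hx r hr
      have h1 : ∀ᶠ t : ℝ≥0 in U, slope (fun r => ‖F r‖) x (x + t) < r := by
        have h2 := (hFU x hx.1).norm
        rw [norm_zero] at h2
        filter_upwards [h2.eventually (gt_mem_nhds hr), hU self_mem_nhdsWithin] with t ht ht0
        refine lt_of_le_of_lt ?_ ht
        have h0 : (0 : ℝ) < t := ht0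
        rw [slope_def_field, norm_mul, norm_inv, Complex.norm_real, Real.norm_of_nonneg h0.le,
          add_sub_cancel_left, div_eq_inv_mul]
        gcongr
        exact norm_sub_norm_le _ _
      exact ((hcoe x).mono_left hU).frequently h1.frequently
  refine (hslope 0).congr fun t => ?_
  have := key t t.2
  simp only [hF, sub_eq_zero] at this
  simp [← this]

/-! ### `σ`-weak convergence and compactness on bounded sets. -/

variable {H : Type*} [NormedAddCommGroup H] [InnerProductSpace ℂ H] [CompleteSpace H]

theorem sqSummable_single (v : H) : SqSummable (Pi.single 0 v : ℕ → H) :=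
  summable_of_ne_finset_zero (s := {0}) fun n hn => by
    simp [Pi.single_eq_of_ne (Finset.notMem_singleton.mp hn)]

theorem traceFunctional_single (u v : H) (D : H →L[ℂ] H) :
    traceFunctional (Pi.single 0 u : ℕ → H) (Pi.single 0 v) D = ⟪u, D v⟫_ℂ := by
  rw [traceFunctional, tsum_eq_single 0 fun n hn => by simp [Pi.single_eq_of_ne hn]]
  simp

theorem SigmaWeakTendsto.inner {α : Type*} {f : α → H →L[ℂ] H} {l : Filter α} {B : H →L[ℂ] H}
    (hf : SigmaWeakTendsto f l B) (u v : H) :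
    Tendsto (fun a => ⟪u, f a v⟫_ℂ) l (𝓝 ⟪u, B v⟫_ℂ) := by
  simpa only [traceFunctional_single] using
    sigmaWeakTendsto_iff.mp hf _ _ (sqSummable_single u) (sqSummable_single v)

/-- On bounded sets, convergence of matrix elements implies `σ`-weak convergence. -/
theorem sigmaWeakTendsto_of_bounded {α : Type*} {f : α → H →L[ℂ] H} {l : Filter α}
    {B : H →L[ℂ] H} {C : ℝ} (hC : ∀ᶠ a in l, ‖f a‖ ≤ C)
    (h : ∀ u v, Tendsto (fun a => ⟪u, f a v⟫_ℂ) l (𝓝 ⟪u, B v⟫_ℂ)) :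
    SigmaWeakTendsto f l B := by
  rw [sigmaWeakTendsto_iff]
  intro x y hx hy
  refine tendsto_tsum_of_dominated_convergence
    (bound := fun n => C * (‖x n‖ ^ 2 + ‖y n‖ ^ 2)) ((hx.add hy).mul_left _)
    (fun n => h (x n) (y n)) ?_
  filter_upwards [hC] with a ha n
  have h1 := norm_inner_le_norm (𝕜 := ℂ) (x n) (f a (y n))
  have h2 := mul_le_mul_of_nonneg_left ((f a).le_of_opNorm_le ha (y n)) (norm_nonneg (x n))
  have hC0 : 0 ≤ C := (norm_nonneg _).trans ha
  nlinarith [mul_nonneg hC0 (sq_nonneg (‖x n‖ - ‖y n‖)),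
    mul_nonneg hC0 (sq_nonneg (‖x n‖)), mul_nonneg hC0 (sq_nonneg (‖y n‖))]

/-- Bounded sets of operators are relatively `σ`-weakly compact. -/
theorem exists_sigmaWeakTendsto_of_bounded {α : Type*} {f : α → H →L[ℂ] H} (U : Ultrafilter α)
    {C : ℝ} (hC : ∀ᶠ a in (U : Filter α), ‖f a‖ ≤ C) : ∃ B, SigmaWeakTendsto f U B := by
  have hb : ∀ u v, ∀ᶠ a in (U : Filter α), ‖⟪f a u, v⟫_ℂ‖ ≤ C * ‖u‖ * ‖v‖ := fun u v => by
    filter_upwards [hC] with a ha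
    exact (norm_inner_le_norm _ _).trans
      (mul_le_mul_of_nonneg_right ((f a).le_of_opNorm_le ha u) (norm_nonneg v))
  have hlim : ∀ u v, ∃ c : ℂ, Tendsto (fun a => ⟪f a u, v⟫_ℂ) U (𝓝 c) := fun u v => by
    obtain ⟨c, -, hc⟩ := (isCompact_closedBall (0 : ℂ) (C * ‖u‖ * ‖v‖)).ultrafilter_le_nhds
      (U.map fun a => ⟪f a u, v⟫_ℂ) (by
        rw [le_principal_iff, Ultrafilter.coe_map, mem_map]
        filter_upwards [hb u v] with a ha
        simpa using ha)
    exact ⟨c, hc⟩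
  choose β hβ using hlim
  -- The limits of the matrix elements form a bounded sesquilinear form, which the Riesz
  -- representation turns into an operator.
  let L : H →ₗ⋆[ℂ] H →ₗ[ℂ] ℂ := LinearMap.mk₂'ₛₗ _ _ β
    (fun u u' v => tendsto_nhds_unique (hβ _ _)
      (((hβ u v).add (hβ u' v)).congr fun a => by simp))
    (fun c u v => tendsto_nhds_unique (hβ _ _)
      (((hβ u v).const_mul _).congr fun a => by simp [mul_comm]))
    (fun u v v' => tendsto_nhds_unique (hβ _ _)
      (((hβ u v).add (hβ u v')).congr fun a => by simp))
    (fun c u v => tendsto_nhds_unique (hβ _ _)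
      (((hβ u v).const_mul _).congr fun a => by simp))
  let L' : H →L⋆[ℂ] H →L[ℂ] ℂ := L.mkContinuous₂ C fun u v =>
    le_of_tendsto (hβ u v).norm (hb u v)
  refine ⟨InnerProductSpace.continuousLinearMapOfBilin L', sigmaWeakTendsto_of_bounded hC
    fun u v => ?_⟩
  have h1 : ⟪InnerProductSpace.continuousLinearMapOfBilin L' v, u⟫_ℂ = β v u :=
    InnerProductSpace.continuousLinearMapOfBilin_apply _ _ _
  have h2 := (Complex.continuous_conj.tendsto _).comp (hβ v u)
  rw [← h1, inner_conj_symm] at h2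
  exact h2.congr fun a => inner_conj_symm _ _

/-- A sequence of operators with bounded matrix elements is bounded. -/
theorem exists_norm_le_of_inner_bounded {ι : Type*} {f : ι → H →L[ℂ] H}
    (h : ∀ u v, ∃ C, ∀ i, ‖⟪u, f i v⟫_ℂ‖ ≤ C) : ∃ C, ∀ i, ‖f i‖ ≤ C := by
  refine banach_steinhaus fun v => ?_
  obtain ⟨C, hC⟩ := banach_steinhaus (g := fun i => innerSL ℂ (f i v)) fun u => by
    obtain ⟨C, hC⟩ := h u v
    exact ⟨C, fun i => by
      rw [innerSL_apply_apply, ← inner_conj_symm, RCLike.norm_conj]; exact hC i⟩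
  exact ⟨C, fun i => by simpa using hC i⟩

/-! ### The domain of the generator via bounded difference quotients. -/

namespace QuantumMarkovSemigroup

variable (S : QuantumMarkovSemigroup H)

/-- The difference quotients of an element of the domain are bounded. -/
theorem isBigO_of_mem_domain {A : H →L[ℂ] H} (hA : A ∈ S.generator.domain) :
    (fun t : ℝ≥0 => S.map t A - A) =O[𝓝[>] 0] fun t : ℝ≥0 => (t : ℝ) := by
  obtain ⟨B, hB⟩ := hA
  by_contra hO
  -- A convergent net need not be bounded, so a sequence of bad times is extracted, to which uniform
  -- boundedness applies.
  have hex : ∀ n : ℕ, ∃ t : ℝ≥0, (0 < t ∧ t < 1 / (n + 1)) ∧ n * (t : ℝ) < ‖S.map t A - A‖ := by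
    intro n
    by_contra! hcon
    refine hO (Asymptotics.IsBigO.of_bound n ?_)
    have : Set.Ioo (0 : ℝ≥0) (1 / (n + 1)) ∈ 𝓝[>] (0 : ℝ≥0) := Ioo_mem_nhdsGT (by positivity)
    filter_upwards [this] with t ht
    simpa using hcon t ht
  choose t ht hbig using hex
  have htend : Tendsto t atTop (𝓝[>] 0) := by
    refine tendsto_nhdsWithin_iff.mpr ⟨?_, Eventually.of_forall fun n => (ht n).1⟩
    exact tendsto_of_tendsto_of_tendsto_of_le_of_le tendsto_const_nhds
      (tendsto_one_div_add_atTop_nhds_zero_nat (𝕜 := ℝ≥0)) (fun n => (ht n).1.le)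
      (fun n => (ht n).2.le)
  have hB' : SigmaWeakTendsto
    (fun n => (((t n : ℝ≥0) : ℝ) : ℂ)⁻¹ • (S.map (t n) A - A)) atTop B := hB.comp htend
  obtain ⟨C, hC⟩ := exists_norm_le_of_inner_bounded
    (f := fun n => (((t n : ℝ≥0) : ℝ) : ℂ)⁻¹ • (S.map (t n) A - A)) fun u v => by
    obtain ⟨C, hC⟩ := (Metric.isBounded_range_of_tendsto _ (hB'.inner u v)).exists_norm_le
    exact ⟨C, fun i => hC _ ⟨i, rfl⟩⟩
  obtain ⟨n, hn⟩ := exists_nat_gt C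
  have h0 : (0 : ℝ) < t n := (ht n).1
  have h1 := hC n
  rw [norm_smul, norm_inv, Complex.norm_real, Real.norm_of_nonneg h0.le, inv_mul_le_iff₀ h0] at h1
  nlinarith [hbig n]

theorem sigmaWeakTendsto_map {α : Type*} {f : α → H →L[ℂ] H} {l : Filter α} {B : H →L[ℂ] H}
    (hf : SigmaWeakTendsto f l B) (t : ℝ≥0) :
    SigmaWeakTendsto (fun a => S.map t (f a)) l (S.map t B) :=
  (@Continuous.tendsto _ _ (sigmaWeak H) (sigmaWeak H) _ (S.sigmaWeak_continuous t) B).comp hf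

theorem continuous_traceFunctional_map {x y : ℕ → H} (hx : SqSummable x) (hy : SqSummable y)
    (A : H →L[ℂ] H) : Continuous fun t => traceFunctional x y (S.map t A) := by
  refine continuous_iff_continuousAt.mpr fun t => ?_
  have : SigmaWeakTendsto (fun t => S.map t A) (𝓝 t) (S.map t A) :=
    @Continuous.tendsto _ _ _ (sigmaWeak H) _ (S.sigmaWeak_continuous_orbit A) t
  exact sigmaWeakTendsto_iff.mp this x y hx hy

/-- By compactness the quotients converge along an ultrafilter to some `B`. Applying the `σ`-weakly
continuous `T_r` shows that `r ↦ T_r A` has right slope `T_r B` along the same ultrafilter at every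
`r`; since `T_r B` is continuous in `r`, the limit at `0` exists along the full filter. -/
theorem mem_domain_of_isBigO {A : H →L[ℂ] H}
    (hA : (fun t : ℝ≥0 => S.map t A - A) =O[𝓝[>] 0] fun t : ℝ≥0 => (t : ℝ)) :
    A ∈ S.generator.domain := by
  obtain ⟨C, hC⟩ := hA.bound
  let U : Ultrafilter ℝ≥0 := Ultrafilter.of (𝓝[>] 0)
  have hU : (U : Filter ℝ≥0) ≤ 𝓝[>] 0 := Ultrafilter.of_le _
  obtain ⟨B, hB⟩ := exists_sigmaWeakTendsto_of_bounded
    (f := fun t : ℝ≥0 => ((t : ℝ) : ℂ)⁻¹ • (S.map t A - A)) U (C := C) <| by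
      filter_upwards [hU hC, hU self_mem_nhdsWithin] with t ht ht0
      have h0 : (0 : ℝ) < t := ht0
      rw [norm_smul, norm_inv, Complex.norm_real, Real.norm_of_nonneg h0.le, inv_mul_le_iff₀ h0,
        mul_comm]
      simpa using ht
  refine ⟨B, sigmaWeakTendsto_iff.mpr fun x y hx hy => ?_⟩
  have hsub : ∀ X Y : H →L[ℂ] H,
      traceFunctional x y (X - Y) = traceFunctional x y X - traceFunctional x y Y := fun X Y => by
    have := traceFunctional_add hx hy (X - Y) Y
    rw [sub_add_cancel] at this
    rw [this, add_sub_cancel_right]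
  have hquot : ∀ (t : ℝ≥0) (X Y : H →L[ℂ] H), traceFunctional x y (((t : ℝ) : ℂ)⁻¹ • (X - Y))
      = ((t : ℝ) : ℂ)⁻¹ * (traceFunctional x y X - traceFunctional x y Y) := fun t X Y => by
    rw [traceFunctional_smul, hsub]
  have main := tendsto_slope_zero_of_tendsto_slope_filter
    (f := fun r => traceFunctional x y (S.map r.toNNReal A))
    (g := fun r => traceFunctional x y (S.map r.toNNReal B))
    ((S.continuous_traceFunctional_map hx hy A).comp continuous_real_toNNReal)
    ((S.continuous_traceFunctional_map hx hy B).comp continuous_real_toNNReal) hU fun r hr => by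
      have := sigmaWeakTendsto_iff.mp (S.sigmaWeakTendsto_map hB r.toNNReal) x y hx hy
      refine this.congr fun t => ?_
      rw [_root_.map_smul, _root_.map_sub, hquot, ← S.map_add,
        Real.toNNReal_add hr (NNReal.coe_nonneg t), Real.toNNReal_coe]
  simpa [S.map_zero, hquot] using main

/-- The domain of the generator consists of the operators with bounded difference quotients. -/
theorem mem_domain_iff_isBigO {A : H →L[ℂ] H} : A ∈ S.generator.domain ↔
    (fun t : ℝ≥0 => S.map t A - A) =O[𝓝[>] 0] fun t : ℝ≥0 => (t : ℝ) :=
  ⟨S.isBigO_of_mem_domain, S.mem_domain_of_isBigO⟩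

end QuantumMarkovSemigroup

/-! ### Completely positive maps and the Schwarz defect. -/

theorem exists_eq_star_mul_self_of_nonneg {A : Type*} [NonUnitalCStarAlgebra A] [PartialOrder A]
    [StarOrderedRing A] {a : A} (ha : 0 ≤ a) : ∃ b, a = star b * b :=
  CStarAlgebra.nonneg_iff_eq_star_mul_self.mp ha

/-- A positive matrix of operators has the form `∑ₗ Nₗᵢ* Nₗⱼ`. -/
theorem exists_gram_of_nonneg {ι : Type*} [Fintype ι] {M : CStarMatrix ι ι (H →L[ℂ] H)}
    (hM : 0 ≤ M) :
    ∃ N : ι → ι → H →L[ℂ] H, ∀ i j, M i j = ∑ l, star (N l i) * N l j := by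
  obtain ⟨N, hN⟩ := exists_eq_star_mul_self_of_nonneg hM
  refine ⟨fun i j => N i j, fun i j => ?_⟩
  rw [hN, CStarMatrix.mul_apply]
  rfl

/-- A completely positive map sends Gram matrices to Gram matrices. -/
theorem exists_gram_map (Φ : (H →L[ℂ] H) →CP (H →L[ℂ] H)) {ι : Type*} [Fintype ι]
    (X : ι → H →L[ℂ] H) :
    ∃ N : ι → ι → H →L[ℂ] H, ∀ i j, Φ (star (X i) * X j) = ∑ l, star (N l i) * N l j := by
  classical
  rcases isEmpty_or_nonempty ι with hι | ⟨⟨o⟩⟩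
  · exact ⟨0, isEmptyElim⟩
  -- A square matrix whose only nonzero row is `X`, so that `R* R` has entries `Xᵢ* Xⱼ`.
  let R : CStarMatrix ι ι (H →L[ℂ] H) :=
    CStarMatrix.ofMatrix (Matrix.of fun i j => if i = o then X j else 0)
  have hR : ∀ i j, (star R * R) i j = star (X i) * X j := fun i j => by
    rw [CStarMatrix.mul_apply, Finset.sum_eq_single o]
    · have h1 : star R i o = star (R o i) := rfl
      rw [h1]
      simp [R]
    · intro l _ hl
      have h0 : R l j = 0 := by simp [R, hl]
      rw [h0, mul_zero]
    · simp
  obtain ⟨N, hN⟩ := exists_gram_of_nonneg (Φ.map_cstarMatrix_nonneg _ (star_mul_self_nonneg R))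
  refine ⟨N, fun i j => ?_⟩
  rw [← hN, ← hR]
  rfl

/-- Completely positive maps commute with the adjoint. -/
theorem map_star_of_completelyPositive (Φ : (H →L[ℂ] H) →CP (H →L[ℂ] H)) (A : H →L[ℂ] H) :
    Φ (star A) = star (Φ A) := by
  obtain ⟨N, hN⟩ := exists_gram_map Φ ![1, A]
  have h1 := hN 0 1
  have h2 := hN 1 0
  simp only [Matrix.cons_val_zero, Matrix.cons_val_one, star_one, one_mul, mul_one] at h1 h2
  rw [h1, h2]
  simp

theorem sum_star_mul_map_mul_nonneg (Φ : (H →L[ℂ] H) →CP (H →L[ℂ] H)) {ι : Type*}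
    [Fintype ι] (X R : ι → H →L[ℂ] H) :
    0 ≤ ∑ i, ∑ j, star (R i) * Φ (star (X i) * X j) * R j := by
  obtain ⟨N, hN⟩ := exists_gram_map Φ X
  have : ∑ i, ∑ j, star (R i) * Φ (star (X i) * X j) * R j
      = ∑ l, star (∑ i, N l i * R i) * ∑ j, N l j * R j := by
    simp only [hN, star_sum, star_mul, Finset.sum_mul, Finset.mul_sum]
    rw [Finset.sum_comm]
    refine (Finset.sum_congr rfl fun j _ => Finset.sum_comm).trans ?_
    rw [Finset.sum_comm]
    exact Finset.sum_congr rfl fun l _ => Finset.sum_congr rfl fun j _ =>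
      Finset.sum_congr rfl fun i _ => by simp only [mul_assoc]
  rw [this]
  exact Finset.sum_nonneg fun l _ => star_mul_self_nonneg _

/-- The form of a Gram matrix of operators is positive. -/
theorem sum_inner_gram_nonneg {ι κ : Type*} [Fintype ι] [Fintype κ] (N : κ → ι → H →L[ℂ] H)
    (ξ : ι → H) : 0 ≤ ∑ i, ∑ j, ⟪ξ i, (∑ l, star (N l i) * N l j) (ξ j)⟫_ℂ := by
  have : ∑ i, ∑ j, ⟪ξ i, (∑ l, star (N l i) * N l j) (ξ j)⟫_ℂ
      = ∑ l, ⟪∑ i, N l i (ξ i), ∑ j, N l j (ξ j)⟫_ℂ := by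
    simp only [sum_inner, inner_sum, sum_apply, mul_apply_eq_comp,
      ContinuousLinearMap.star_eq_adjoint, ContinuousLinearMap.adjoint_inner_right]
    rw [Finset.sum_comm]
    refine (Finset.sum_congr rfl fun j _ => Finset.sum_comm).trans ?_
    rw [Finset.sum_comm]
  rw [this]
  exact Finset.sum_nonneg fun l _ => by
    rw [inner_self_eq_norm_sq_to_K]; positivity

theorem sum_inner_map_nonneg (Φ : (H →L[ℂ] H) →CP (H →L[ℂ] H)) {ι : Type*} [Fintype ι]
    (X : ι → H →L[ℂ] H) (ξ : ι → H) :
    0 ≤ ∑ i, ∑ j, ⟪ξ i, Φ (star (X i) * X j) (ξ j)⟫_ℂ := by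
  obtain ⟨N, hN⟩ := exists_gram_map Φ X
  simp only [hN]
  exact sum_inner_gram_nonneg N ξ

/-- The defect in the Schwarz inequality for a map `Φ`. -/
def schwarzDefect (Φ : (H →L[ℂ] H) →CP (H →L[ℂ] H)) (X : H →L[ℂ] H) : H →L[ℂ] H :=
  Φ (star X * X) - star (Φ X) * Φ X

section Defect

variable (Φ : (H →L[ℂ] H) →CP (H →L[ℂ] H))

theorem schwarzDefect_nonneg (h1 : Φ 1 = 1) (X : H →L[ℂ] H) : 0 ≤ schwarzDefect Φ X := by
  have := sum_star_mul_map_mul_nonneg Φ ![X, 1] ![1, -Φ X]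
  simp only [Fin.sum_univ_two, Matrix.cons_val_zero, Matrix.cons_val_one, star_one, mul_one,
    one_mul, h1, map_star_of_completelyPositive, star_neg] at this
  refine this.trans_eq ?_
  rw [schwarzDefect]
  noncomm_ring

/-- Parallelogram identity: the difference of the two sides is the defect of `X - Y`. -/
theorem schwarzDefect_add_le (h1 : Φ 1 = 1) (X Y : H →L[ℂ] H) :
    schwarzDefect Φ (X + Y) ≤ 2 • (schwarzDefect Φ X + schwarzDefect Φ Y) := by
  rw [← sub_nonneg]
  refine (schwarzDefect_nonneg Φ h1 (X - Y)).trans_eq ?_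
  simp only [schwarzDefect, star_add, star_sub, mul_add, add_mul, mul_sub, sub_mul, map_add,
    map_sub]
  abel

/-- In a Stinespring picture `Φ(X) = V* π(X) V`, `P = V V*`, the defect of `X` is `|(1-P)π(X)V|²`.
Splitting `π(AB)V = π(A)(1-P)π(B)V + π(A)VΦ(B)` and using `|x+y|² ≤ 2(|x|²+|y|²)` gives the bound.
The proof writes these squares without the dilation. -/
theorem schwarzDefect_mul_le (h1 : Φ 1 = 1) (A B : H →L[ℂ] H) :
    schwarzDefect Φ (A * B) ≤ 2 • (((‖A‖ ^ 2 : ℝ) : ℂ) • schwarzDefect Φ B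
      + star (Φ B) * schwarzDefect Φ A * Φ B) := by
  obtain ⟨C, hC⟩ : ∃ C : H →L[ℂ] H, ((‖A‖ ^ 2 : ℝ) : ℂ) • (1 : H →L[ℂ] H) - star A * A
      = star C * C := by
    refine CStarAlgebra.nonneg_iff_eq_star_mul_self.mp (sub_nonneg.mpr ?_)
    have := CStarAlgebra.star_mul_le_algebraMap_norm_sq (a := A)
    rw [Algebra.algebraMap_eq_smul_one] at this
    exact this.trans_eq (Complex.coe_smul _ _).symm
  have hCC : ∀ Y Z : H →L[ℂ] H, star (C * Y) * (C * Z)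
      = ((‖A‖ ^ 2 : ℝ) : ℂ) • (star Y * Z) - star (A * Y) * (A * Z) := fun Y Z => by
    have : star (C * Y) * (C * Z) = star Y * (star C * C) * Z := by
      rw [star_mul]; simp only [mul_assoc]
    rw [this, ← hC, star_mul]
    simp only [mul_sub, sub_mul, mul_smul_comm, smul_mul_assoc, mul_one, mul_assoc]
  -- `p1` is `|π(C)(1-P)π(B)V|²`, the loss in the bound by `‖A‖²`. `p2` is `|x-y|²`, for the
  -- `(1-P)`-parts `x`, `y` of the two summands, plus `|Φ(AB) - Φ(A)Φ(B)|²`, which `p3` supplies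
  -- once more. The slack is `2 p1 + p2 + p3`.
  have p1 := sum_star_mul_map_mul_nonneg Φ ![C * B, C * 1] ![1, -Φ B]
  have p2 := sum_star_mul_map_mul_nonneg Φ ![A * B, A, 1] ![1, -(2 • Φ B), Φ A * Φ B]
  have p3 : 0 ≤ star (Φ A * Φ B - Φ (A * B)) * (Φ A * Φ B - Φ (A * B)) := star_mul_self_nonneg _
  simp only [Fin.sum_univ_two, Matrix.cons_val_zero, Matrix.cons_val_one, hCC] at p1
  simp only [Fin.sum_univ_three, Matrix.cons_val_zero, Matrix.cons_val_one, Matrix.cons_val_two,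
    Matrix.head_cons, Matrix.tail_cons] at p2
  rw [← sub_nonneg]
  refine (add_nonneg (add_nonneg (nsmul_nonneg p1 2) p2) p3).trans_eq ?_
  have hs1 : Φ (star B * star A) = star (Φ (A * B)) := by
    rw [← star_mul, map_star_of_completelyPositive]
  simp only [schwarzDefect, star_one, mul_one, one_mul, map_sub, map_smul, h1, star_neg,
    map_star_of_completelyPositive, star_mul, star_sub, star_nsmul, hs1, mul_sub, sub_mul,
    smul_sub, smul_add, mul_neg, neg_mul, mul_smul_comm, smul_mul_assoc,
    mul_assoc]
  abel

end Defect

/-! ### The domain algebra. -/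

namespace QuantumMarkovSemigroup

variable (S : QuantumMarkovSemigroup H)

theorem star_mem_domain {A : H →L[ℂ] H} (hA : A ∈ S.generator.domain) :
    star A ∈ S.generator.domain := by
  rw [mem_domain_iff_isBigO] at *
  refine (Asymptotics.isBigO_norm_left.mp ?_)
  refine (Asymptotics.isBigO_norm_left.mpr hA).congr_left fun t => ?_
  rw [map_star_of_completelyPositive, ← star_sub, norm_star]

theorem isBigO_map_one {A : H →L[ℂ] H} (hA : A ∈ S.generator.domain) :
    (fun t : ℝ≥0 => S.map t A) =O[𝓝[>] 0] fun _ : ℝ≥0 => (1 : ℝ) := by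
  have h1 : (fun t : ℝ≥0 => (t : ℝ)) =O[𝓝[>] 0] fun _ : ℝ≥0 => (1 : ℝ) := by
    have : Tendsto (fun t : ℝ≥0 => (t : ℝ)) (𝓝[>] 0) (𝓝 ((0 : ℝ≥0) : ℝ)) :=
      (NNReal.continuous_coe.tendsto 0).mono_left nhdsWithin_le_nhds
    exact this.isBigO_one ℝ
  have h2 := ((S.isBigO_of_mem_domain hA).trans h1).add
    (Asymptotics.isBigO_const_const A (one_ne_zero (α := ℝ)) (𝓝[>] (0 : ℝ≥0)))
  simpa using h2

/-- For `A` in the domain, `T_t(A)* T_t(A) - A* A` is already `O(t)`, so the defect and the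
increment of `A* A` differ by `O(t)`. -/
theorem star_mul_self_mem_domain_iff {A : H →L[ℂ] H} (hA : A ∈ S.generator.domain) :
    star A * A ∈ S.generator.domain ↔
      (fun t : ℝ≥0 => schwarzDefect (S.map t) A) =O[𝓝[>] 0] fun t : ℝ≥0 => (t : ℝ) := by
  have h1 := S.isBigO_of_mem_domain hA
  have h2 := S.isBigO_of_mem_domain (S.star_mem_domain hA)
  have h3 : (fun t : ℝ≥0 => star (S.map t A) * S.map t A - star A * A)
      =O[𝓝[>] 0] fun t : ℝ≥0 => (t : ℝ) := by
    have h4 := h2.mul (S.isBigO_map_one hA)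
    have h5 := (Asymptotics.isBigO_const_const (star A) (one_ne_zero (α := ℝ))
      (𝓝[>] (0 : ℝ≥0))).mul h1
    simp only [mul_one, one_mul] at h4 h5
    refine (h4.add h5).congr_left fun t => ?_
    rw [map_star_of_completelyPositive]
    noncomm_ring
  rw [mem_domain_iff_isBigO]
  constructor
  · intro h
    refine (h.sub h3).congr_left fun t => ?_
    rw [schwarzDefect]
    abel
  · intro h
    refine (h.add h3).congr_left fun t => ?_
    rw [schwarzDefect]
    abel

theorem isBigO_schwarzDefect_of_le {A : H →L[ℂ] H} {F : ℝ≥0 → H →L[ℂ] H}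
    (hF : F =O[𝓝[>] 0] fun t : ℝ≥0 => (t : ℝ)) (h : ∀ t, schwarzDefect (S.map t) A ≤ F t) :
    (fun t : ℝ≥0 => schwarzDefect (S.map t) A) =O[𝓝[>] 0] fun t : ℝ≥0 => (t : ℝ) :=
  (Asymptotics.IsBigO.of_bound 1 (Eventually.of_forall fun t => by
    rw [one_mul]
    exact CStarAlgebra.norm_le_norm_of_nonneg_of_le
      (schwarzDefect_nonneg _ (S.map_one t) A) (h t))).trans hF

/-- The operators `A` such that `A` and `A* A` lie in the domain of the generator. -/
def leftDomain : Submodule ℂ (H →L[ℂ] H) where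
  carrier := {A | A ∈ S.generator.domain ∧ star A * A ∈ S.generator.domain}
  add_mem' := by
    rintro A B ⟨hA, hA'⟩ ⟨hB, hB'⟩
    have h := add_mem hA hB
    refine ⟨h, (S.star_mul_self_mem_domain_iff h).mpr ?_⟩
    rw [S.star_mul_self_mem_domain_iff hA] at hA'
    rw [S.star_mul_self_mem_domain_iff hB] at hB'
    refine S.isBigO_schwarzDefect_of_le ?_ fun t => schwarzDefect_add_le _ (S.map_one t) A B
    simp only [two_smul]
    exact (hA'.add hB').add (hA'.add hB')
  zero_mem' := by simp
  smul_mem' := by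
    rintro c A ⟨hA, hA'⟩
    refine ⟨Submodule.smul_mem _ c hA, ?_⟩
    simp only [star_smul, smul_mul_assoc, mul_smul_comm]
    exact Submodule.smul_mem _ _ (Submodule.smul_mem _ _ hA')

/-- Polarisation, available because `leftDomain` is a subspace. -/
theorem star_mul_mem_domain {A B : H →L[ℂ] H} (hA : A ∈ S.leftDomain) (hB : B ∈ S.leftDomain) :
    star A * B ∈ S.generator.domain := by
  have key : star A * B = (4 : ℂ)⁻¹ • ((star (A + B) * (A + B) - star (A - B) * (A - B))
      - Complex.I • (star (A + Complex.I • B) * (A + Complex.I • B)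
        - star (A - Complex.I • B) * (A - Complex.I • B))) := by
    have hI : ∀ X : H →L[ℂ] H, Complex.I • Complex.I • X = -X := fun X => by
      rw [smul_smul, Complex.I_mul_I, neg_one_smul]
    have hI' : star Complex.I = -Complex.I := Complex.conj_I
    simp only [star_add, star_sub, star_smul, hI', mul_add, add_mul, mul_sub, sub_mul,
      neg_mul, smul_mul_assoc, mul_smul_comm, neg_smul, smul_add, smul_sub, smul_neg, hI, neg_neg]
    module
  rw [key]
  have hI := S.leftDomain.smul_mem Complex.I hB
  exact Submodule.smul_mem _ _ (sub_mem
    (sub_mem (add_mem hA hB).2 (sub_mem hA hB).2)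
    (Submodule.smul_mem _ _ (sub_mem (add_mem hA hI).2 (sub_mem hA hI).2)))

theorem mul_mem_leftDomain {A B : H →L[ℂ] H} (hA : A ∈ S.leftDomain) (hB : B ∈ S.leftDomain)
    (hAB : A * B ∈ S.generator.domain) : A * B ∈ S.leftDomain := by
  refine ⟨hAB, (S.star_mul_self_mem_domain_iff hAB).mpr ?_⟩
  have hA' := (S.star_mul_self_mem_domain_iff hA.1).mp hA.2
  have hB' := (S.star_mul_self_mem_domain_iff hB.1).mp hB.2
  refine S.isBigO_schwarzDefect_of_le ?_ fun t => schwarzDefect_mul_le _ (S.map_one t) A B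
  have h1 := (((S.isBigO_map_one (S.star_mem_domain hB.1)).mul hA').mul
    (S.isBigO_map_one hB.1))
  simp only [one_mul, mul_one, map_star_of_completelyPositive] at h1
  have h2 := (hB'.const_smul_left (((‖A‖ ^ 2 : ℝ) : ℂ))).add h1
  simp only [two_smul]
  exact h2.add h2

/-- The operators `A` such that `A`, `A* A` and `A A*` lie in the domain of the generator form a
`*`-algebra. -/
def squareDomain : NonUnitalStarSubalgebra ℂ (H →L[ℂ] H) where
  carrier := {A | A ∈ S.leftDomain ∧ star A ∈ S.leftDomain}
  add_mem' := fun hA hB => ⟨add_mem hA.1 hB.1, by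
    rw [star_add]; exact add_mem hA.2 hB.2⟩
  zero_mem' := ⟨zero_mem _, by rw [star_zero]; exact zero_mem _⟩
  smul_mem' := fun c A hA => ⟨Submodule.smul_mem _ c hA.1, by
    rw [star_smul]; exact Submodule.smul_mem _ _ hA.2⟩
  mul_mem' := by
    rintro A B ⟨hA, hA'⟩ ⟨hB, hB'⟩
    have h1 : A * B ∈ S.generator.domain := by
      simpa using S.star_mul_mem_domain hA' hB
    refine ⟨S.mul_mem_leftDomain hA hB h1, ?_⟩
    have h2 := S.star_mem_domain h1
    rw [star_mul] at h2 ⊢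
    exact S.mul_mem_leftDomain hB' hA' h2
  star_mem' := fun hA => ⟨hA.2, by rw [star_star]; exact hA.1⟩

theorem mem_squareDomain_iff {A : H →L[ℂ] H} : A ∈ S.squareDomain ↔ A ∈ S.generator.domain ∧
    star A * A ∈ S.generator.domain ∧ A * star A ∈ S.generator.domain := by
  constructor
  · rintro ⟨h1, h2⟩
    exact ⟨h1.1, h1.2, by simpa using h2.2⟩
  · rintro ⟨h1, h2, h3⟩
    exact ⟨⟨h1, h2⟩, S.star_mem_domain h1, by simpa using h3⟩

theorem isGreatest_squareDomain : IsGreatest S.starSubalgebrasInDomain S.squareDomain := by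
  refine ⟨fun A hA => (S.mem_squareDomain_iff.mp hA).1, fun B hB A hA => ?_⟩
  exact S.mem_squareDomain_iff.mpr ⟨hB A hA, hB _ (mul_mem (star_mem hA) hA),
    hB _ (mul_mem hA (star_mem hA))⟩

theorem domainAlgebra_eq_squareDomain : S.domainAlgebra = S.squareDomain :=
  S.isGreatest_squareDomain.isLUB.sSup_eq

theorem isGreatest_domainAlgebra : IsGreatest S.starSubalgebrasInDomain S.domainAlgebra := by
  rw [domainAlgebra_eq_squareDomain]
  exact S.isGreatest_squareDomain

theorem mem_domainAlgebra_iff {A : H →L[ℂ] H} : A ∈ S.domainAlgebra ↔ A ∈ S.generator.domain ∧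
    star A * A ∈ S.generator.domain ∧ A * star A ∈ S.generator.domain := by
  rw [domainAlgebra_eq_squareDomain]
  exact S.mem_squareDomain_iff

end QuantumMarkovSemigroup

/-! ### Rank one test matrices and the associate vector. -/

open InnerProductSpace (rankOne)

theorem mul_rankOne (A : H →L[ℂ] H) (x w : H) : A * rankOne ℂ x w = rankOne ℂ (A x) w := by
  ext v
  simp [InnerProductSpace.rankOne_apply]

theorem star_rankOne (x w : H) : star (rankOne ℂ x w) = rankOne ℂ w x := by
  rw [ContinuousLinearMap.star_eq_adjoint, InnerProductSpace.adjoint_rankOne]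

theorem rankOne_mul (A : H →L[ℂ] H) (x w : H) :
    rankOne ℂ w x * A = star (rankOne ℂ (star A x) w) := by
  rw [← mul_rankOne, star_mul, star_star, star_rankOne]

/-- Complete positivity tested on the positive matrix with blocks `Aᵢⱼ`, `Aᵢⱼ |uⱼ⟩⟨w|`,
`|w⟩⟨uᵢ| Aᵢⱼ` and `|w⟩⟨uᵢ| Aᵢⱼ |uⱼ⟩⟨w|`. -/
theorem sum_inner_map_rankOne_nonneg (Φ : (H →L[ℂ] H) →CP (H →L[ℂ] H)) {ι : Type*} [Fintype ι]
    {M : CStarMatrix ι ι (H →L[ℂ] H)} (hM : 0 ≤ M) (u : ι → H) (w h : H) :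
    0 ≤ ∑ i, ∑ j, (⟪u i, Φ (M i j) (u j)⟫_ℂ - ⟪u i, Φ (rankOne ℂ (M i j (u j)) w) h⟫_ℂ
      - ⟪Φ (rankOne ℂ (star (M i j) (u i)) w) h, u j⟫_ℂ
      + ⟪u i, M i j (u j)⟫_ℂ * ⟪h, Φ (rankOne ℂ w w) h⟫_ℂ) := by
  obtain ⟨N, hN⟩ := exists_gram_of_nonneg hM
  have hterm : ∀ i j, ⟪u i, Φ (M i j) (u j)⟫_ℂ - ⟪u i, Φ (rankOne ℂ (M i j (u j)) w) h⟫_ℂ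
      - ⟪Φ (rankOne ℂ (star (M i j) (u i)) w) h, u j⟫_ℂ
      + ⟪u i, M i j (u j)⟫_ℂ * ⟪h, Φ (rankOne ℂ w w) h⟫_ℂ
      = ∑ l, (⟪u i, Φ (star (N l i) * N l j) (u j)⟫_ℂ
        - ⟪u i, Φ (star (N l i) * (N l j * rankOne ℂ (u j) w)) h⟫_ℂ
        - ⟪h, Φ (star (N l i * rankOne ℂ (u i) w) * N l j) (u j)⟫_ℂ
        + ⟪h, Φ (star (N l i * rankOne ℂ (u i) w) * (N l j * rankOne ℂ (u j) w)) h⟫_ℂ) := by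
    intro i j
    have e1 : ∑ l, star (N l i) * (N l j * rankOne ℂ (u j) w) = rankOne ℂ (M i j (u j)) w := by
      rw [← mul_rankOne, hN, Finset.sum_mul]
      simp only [mul_assoc]
    have e2 : ∑ l, star (N l i * rankOne ℂ (u i) w) * N l j
        = star (rankOne ℂ (star (M i j) (u i)) w) := by
      rw [← rankOne_mul, hN, Finset.mul_sum]
      simp only [star_mul, star_rankOne, mul_assoc]
    have e3 : ∑ l, star (N l i * rankOne ℂ (u i) w) * (N l j * rankOne ℂ (u j) w)
        = ⟪u i, M i j (u j)⟫_ℂ • rankOne ℂ w w := by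
      have : ⟪u i, M i j (u j)⟫_ℂ • rankOne ℂ w w
          = rankOne ℂ w (u i) * (M i j * rankOne ℂ (u j) w) := by
        rw [mul_rankOne, mul_rankOne]
        simp [InnerProductSpace.rankOne_apply]
      rw [this, hN, Finset.sum_mul, Finset.mul_sum]
      simp only [star_mul, star_rankOne, mul_assoc]
    simp only [Finset.sum_add_distrib, Finset.sum_sub_distrib, ← inner_sum, ← sum_apply, ← map_sum,
      e1, e2, e3, ← hN]
    have hadj : ∀ (X : H →L[ℂ] H) (x y : H), ⟪x, star X y⟫_ℂ = ⟪X x, y⟫_ℂ := fun X x y => by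
      rw [ContinuousLinearMap.star_eq_adjoint, ContinuousLinearMap.adjoint_inner_right]
    rw [map_star_of_completelyPositive, hadj, map_smul, smul_apply, inner_smul_right]
  simp only [hterm]
  rw [Finset.sum_congr rfl fun i _ => Finset.sum_comm, Finset.sum_comm]
  refine Finset.sum_nonneg fun l _ => ?_
  -- For each `l`, complete positivity is applied to the doubled family `Nₗⱼ`, `Nₗⱼ|uⱼ⟩⟨w|`, tested
  -- on `uⱼ` and `-h`.
  refine (sum_inner_map_nonneg Φ (ι := ι ⊕ ι)
    (Sum.elim (N l) fun j => N l j * rankOne ℂ (u j) w) (Sum.elim u fun _ => -h)).trans_eq ?_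
  simp only [Fintype.sum_sum_type, Sum.elim_inl, Sum.elim_inr, map_neg, inner_neg_left,
    inner_neg_right, Finset.sum_add_distrib, Finset.sum_sub_distrib,
    Finset.sum_neg_distrib]
  ring

/-- A vector with `⟨h, T h⟩ = 1` for a positive `T` satisfies `|T h⟩⟨T h| ≤ T`. -/
theorem rankOne_le_of_inner_eq_one {T : H →L[ℂ] H} (hT : T.IsPositive) {h : H}
    (hh : ⟪T h, h⟫_ℂ = 1) : rankOne ℂ (T h) (T h) ≤ T := by
  obtain ⟨D, hD⟩ := exists_eq_star_mul_self_of_nonneg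
    ((ContinuousLinearMap.nonneg_iff_isPositive T).mpr hT)
  have hin : ∀ x y, ⟪T x, y⟫_ℂ = ⟪D x, D y⟫_ℂ := fun x y => by
    rw [hD, mul_apply_eq_comp, ContinuousLinearMap.star_eq_adjoint,
      ContinuousLinearMap.adjoint_inner_left]
  have hnorm : ‖D h‖ = 1 := by
    rw [hin, inner_self_eq_norm_sq_to_K] at hh
    have h2 : ‖D h‖ ^ 2 = 1 := by
      have h3 : ((‖D h‖ ^ 2 : ℝ) : ℂ) = 1 := by push_cast; exact hh
      exact_mod_cast h3
    exact (pow_eq_one_iff_of_nonneg (norm_nonneg _) two_ne_zero).mp h2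
  rw [ContinuousLinearMap.le_def, ContinuousLinearMap.isPositive_iff_complex]
  intro x
  have h1 : ⟪(T - rankOne ℂ (T h) (T h)) x, x⟫_ℂ
      = ((‖D x‖ ^ 2 - ‖⟪D h, D x⟫_ℂ‖ ^ 2 : ℝ) : ℂ) := by
    rw [sub_apply, inner_sub_left, hin, inner_self_eq_norm_sq_to_K,
      InnerProductSpace.rankOne_apply, inner_smul_left, hin, RCLike.conj_mul]
    push_cast
    rfl
  -- Cauchy–Schwarz for the form of `T = D* D`, in which `h` is a unit vector.
  have h2 := norm_inner_le_norm (𝕜 := ℂ) (D h) (D x)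
  rw [hnorm, one_mul] at h2
  rw [h1]
  have h3 : ‖⟪D h, D x⟫_ℂ‖ ^ 2 ≤ ‖D x‖ ^ 2 := by gcongr
  rw [show RCLike.re ((‖D x‖ ^ 2 - ‖⟪D h, D x⟫_ℂ‖ ^ 2 : ℝ) : ℂ) = ‖D x‖ ^ 2 - ‖⟪D h, D x⟫_ℂ‖ ^ 2
    from Complex.ofReal_re _]
  exact ⟨rfl, sub_nonneg.mpr h3⟩

/-- Every `‖kₛ‖²` equals `τ = ∑ t'ₛ`, so `h = τ^(-1/2) ∑ k'ₛ` and `⟨T h, h⟩ = τ⁻¹ ∑ t'ₛ`. -/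
theorem IsAssociateVector.inner_eq_one {T : H →L[ℂ] H} {h : H} (hh : IsAssociateVector T h)
    (hT : T ≠ 0) : ⟪T h, h⟫_ℂ = 1 := by
  obtain ⟨m, k', t', k, hk', ht', rfl, hk, rfl⟩ := hh
  set τ : ℝ := ∑ r, t' r with hτ
  have hτ0 : 0 < τ := by
    refine Finset.sum_pos (fun s _ => ht' s) ?_
    by_contra hne
    rw [Finset.not_nonempty_iff_eq_empty] at hne
    exact hT (by rw [hne, Finset.sum_empty])
  have hnorm : ∀ s, ‖k s‖ ^ 2 = τ := fun s => by
    rw [hk, norm_smul, hk'.1 s, mul_one, Complex.norm_real,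
      Real.norm_of_nonneg (Real.sqrt_nonneg _), Real.sq_sqrt hτ0.le]
  have hcoef : ∀ s, ((‖k s‖ ^ 2 : ℂ))⁻¹ • k s = ((τ⁻¹ * √τ : ℝ) : ℂ) • k' s := fun s => by
    have : (‖k s‖ ^ 2 : ℂ) = ((τ : ℝ) : ℂ) := by rw [← hnorm s]; push_cast; rfl
    rw [this, hk, smul_smul]
    push_cast
    rfl
  simp only [hcoef]
  set c : ℝ := τ⁻¹ * √τ with hc
  have hin : ∀ s, ⟪k' s, ∑ r, (c : ℂ) • k' r⟫_ℂ = c := fun s => by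
    rw [hk'.inner_right_fintype]
  simp only [sum_apply, smul_apply, InnerProductSpace.rankOne_apply, hin, sum_inner,
    inner_smul_left, Complex.conj_ofReal]
  have hc2 : c * c * τ = 1 := by
    rw [hc]
    have := Real.mul_self_sqrt hτ0.le
    field_simp
    nlinarith
  have : ∑ s, (t' s : ℂ) * ((c : ℂ) * (c : ℂ)) = ((c * c * τ : ℝ) : ℂ) := by
    rw [← Finset.sum_mul, hτ]
    push_cast
    ring
  rw [this, hc2, Complex.ofReal_one]

/-! ### Positivity of the generator, the drift `G` and the form `φ`. -/

namespace QuantumMarkovSemigroup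

variable (S : QuantumMarkovSemigroup H)

theorem HasGenerator.inner {A B : H →L[ℂ] H} (hAB : S.HasGenerator A B) (u v : H) :
    Tendsto (fun t : ℝ≥0 => ((t : ℝ) : ℂ)⁻¹ * (⟪u, S.map t A v⟫_ℂ - ⟪u, A v⟫_ℂ)) (𝓝[>] 0)
      (𝓝 ⟪u, B v⟫_ℂ) := by
  simpa [inner_smul_right, inner_sub_right] using SigmaWeakTendsto.inner hAB u v

theorem HasGenerator.inner_left {A B : H →L[ℂ] H} (hAB : S.HasGenerator A B) (u v : H) :
    Tendsto (fun t : ℝ≥0 => ((t : ℝ) : ℂ)⁻¹ * (⟪S.map t A u, v⟫_ℂ - ⟪A u, v⟫_ℂ)) (𝓝[>] 0)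
      (𝓝 ⟪B u, v⟫_ℂ) := by
  have := (Complex.continuous_conj.tendsto _).comp (HasGenerator.inner S hAB v u)
  rw [inner_conj_symm] at this
  refine this.congr fun t => ?_
  simp [map_sub, map_mul]

theorem HasGenerator.inner_self_conj {A B : H →L[ℂ] H} (hAB : S.HasGenerator A B)
    (hA : star A = A) (h : H) : ⟪B h, h⟫_ℂ = ⟪h, B h⟫_ℂ := by
  refine tendsto_nhds_unique (HasGenerator.inner_left S hAB h h)
    ((HasGenerator.inner S hAB h h).congr fun t => ?_)
  have h1 : ∀ X : H →L[ℂ] H, star X = X → ⟪h, X h⟫_ℂ = ⟪X h, h⟫_ℂ := fun X hX => by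
    conv_lhs => rw [← hX]
    rw [ContinuousLinearMap.star_eq_adjoint, ContinuousLinearMap.adjoint_inner_right]
  rw [h1 A hA, h1 (S.map t A) (by rw [← map_star_of_completelyPositive, hA])]

/-- The generator is positive at a positive operator, in the directions it annihilates. -/
theorem HasGenerator.inner_self_nonneg {A B : H →L[ℂ] H} (hAB : S.HasGenerator A B)
    (hA : 0 ≤ A) {h : H} (hh : ⟪h, A h⟫_ℂ = 0) : 0 ≤ ⟪h, B h⟫_ℂ := by
  refine ge_of_tendsto' (HasGenerator.inner S hAB h h) fun t => ?_
  obtain ⟨D, hD⟩ := exists_eq_star_mul_self_of_nonneg hA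
  have h1 := sum_inner_map_nonneg (S.map t) (fun _ : Fin 1 => D) fun _ => h
  rw [hh, sub_zero, hD]
  refine mul_nonneg ?_ (by simpa using h1)
  rw [← Complex.ofReal_inv]
  exact Complex.zero_le_real.mpr (by positivity)

variable {S} in
/-- Conditional complete positivity of the generator, in the form that uses a vector `h` with
`⟨w, h⟩ = 1` to compress the second order part. -/
theorem sum_inner_generator_nonneg {ι : Type*} [Fintype ι] {M : CStarMatrix ι ι (H →L[ℂ] H)}
    (hM : 0 ≤ M) {u : ι → H} {w h : H} (hw : ⟪w, h⟫_ℂ = 1) {L LR LR' : ι → ι → H →L[ℂ] H}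
    {LW : H →L[ℂ] H} (hL : ∀ i j, S.HasGenerator (M i j) (L i j))
    (hR : ∀ i j, S.HasGenerator (rankOne ℂ (M i j (u j)) w) (LR i j))
    (hR' : ∀ i j, S.HasGenerator (rankOne ℂ (star (M i j) (u i)) w) (LR' i j))
    (hW : S.HasGenerator (rankOne ℂ w w) LW) :
    0 ≤ ∑ i, ∑ j, (⟪u i, L i j (u j)⟫_ℂ - ⟪u i, LR i j h⟫_ℂ - ⟪LR' i j h, u j⟫_ℂ
      + ⟪u i, M i j (u j)⟫_ℂ * ⟪h, LW h⟫_ℂ) := by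
  have hlim := tendsto_finsetSum (Finset.univ : Finset ι) fun i _ =>
    tendsto_finsetSum (Finset.univ : Finset ι) fun j _ =>
      (((HasGenerator.inner S (hL i j) (u i) (u j)).sub
        (HasGenerator.inner S (hR i j) (u i) h)).sub
        (HasGenerator.inner_left S (hR' i j) h (u j))).add
        ((HasGenerator.inner S hW h h).const_mul ⟪u i, M i j (u j)⟫_ℂ)
  refine ge_of_tendsto' hlim fun t => ?_
  have h1 := sum_inner_map_rankOne_nonneg (S.map t) hM u w h
  have ht : (0 : ℂ) ≤ ((t : ℝ) : ℂ)⁻¹ := by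
    rw [← Complex.ofReal_inv]
    exact Complex.zero_le_real.mpr (by positivity)
  refine (mul_nonneg ht h1).trans_eq ?_
  have hw' : ⟪h, w⟫_ℂ = 1 := by rw [← inner_conj_symm, hw, _root_.map_one]
  have hadj : ∀ i j, ⟪star (M i j) (u i), u j⟫_ℂ = ⟪u i, M i j (u j)⟫_ℂ := fun i j => by
    rw [ContinuousLinearMap.star_eq_adjoint, ContinuousLinearMap.adjoint_inner_left]
  -- As `⟨w, h⟩ = 1`, the four terms at `t = 0` cancel, so the positive sum at time `t` is itself an
  -- increment.
  simp only [Finset.mul_sum, InnerProductSpace.rankOne_apply, hw, one_smul, hw', hadj]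
  refine Finset.sum_congr rfl fun i _ => Finset.sum_congr rfl fun j _ => ?_
  ring

variable {S} in
/-- The generator restricted to the domain algebra. -/
def generatorOnDomainAlgebra (hD : ∀ A ∈ S.domainAlgebra, A ∈ S.generator.domain) :
    S.domainAlgebra →ₗ[ℂ] (H →L[ℂ] H) :=
  S.generator.toFun ∘ₗ
    { toFun := fun A => ⟨A, hD _ A.2⟩
      map_add' := fun _ _ => rfl
      map_smul' := fun _ _ => rfl }

/-- The map `u ↦ |u⟩⟨w|` into the domain algebra. -/
def rankOneMap (w : H) : S.rankOneSubspace w →ₗ[ℂ] S.domainAlgebra where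
  toFun u := ⟨rankOne ℂ (u : H) w, u.2⟩
  map_add' _ _ := Subtype.ext (by simp)
  map_smul' _ _ := Subtype.ext (by simp)

variable {S} in
/-- The operator `u ↦ L(|u⟩⟨w|) h - c u`. -/
def drift (hD : ∀ A ∈ S.domainAlgebra, A ∈ S.generator.domain) (w h : H) (c : ℂ) :
    S.rankOneSubspace w →ₗ[ℂ] H :=
  (ContinuousLinearMap.apply ℂ H h).toLinearMap ∘ₗ generatorOnDomainAlgebra hD ∘ₗ S.rankOneMap w
    - c • (S.rankOneSubspace w).subtype

variable {S} in
/-- The form `⟨u, L(A) v⟩ - ⟨u, G A v⟩ - ⟨G A* u, v⟩`. -/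
def dissipation (hD : ∀ A ∈ S.domainAlgebra, A ∈ S.generator.domain) {w : H}
    (G : S.rankOneSubspace w →ₗ[ℂ] H) :
    S.domainAlgebra →ₗ[ℂ] (S.rankOneSubspace w →ₗ⋆[ℂ] S.rankOneSubspace w →ₗ[ℂ] ℂ) :=
  have act_add (A : S.domainAlgebra) (x y : S.rankOneSubspace w) :
      S.act A (x + y) = S.act A x + S.act A y := Subtype.ext (by simp [act])
  have act_smul (A : S.domainAlgebra) (c : ℂ) (x : S.rankOneSubspace w) :
      S.act A (c • x) = c • S.act A x := Subtype.ext (by simp [act])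
  have add_act (A B : S.domainAlgebra) (x : S.rankOneSubspace w) :
      S.act (A + B) x = S.act A x + S.act B x := Subtype.ext (by simp [act])
  have smul_act (c : ℂ) (A : S.domainAlgebra) (x : S.rankOneSubspace w) :
      S.act (c • A) x = c • S.act A x := Subtype.ext (by simp [act])
  { toFun A := LinearMap.mk₂'ₛₗ _ _
      (fun u v => ⟪(u : H), generatorOnDomainAlgebra hD A (v : H)⟫_ℂ
        - ⟪(u : H), G (S.act A v)⟫_ℂ - ⟪G (S.act (star A) u), (v : H)⟫_ℂ)
      (fun u u' v => by
        simp only [act_add, _root_.map_add, Submodule.coe_add, inner_add_left]; ring)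
      (fun c u v => by
        simp only [act_smul, map_smul, Submodule.coe_smul, inner_smul_left, smul_eq_mul]; ring)
      (fun u v v' => by
        simp only [act_add, _root_.map_add, Submodule.coe_add, inner_add_right]; ring)
      (fun c u v => by
        simp only [act_smul, map_smul, Submodule.coe_smul, inner_smul_right, smul_eq_mul,
          RingHom.id_apply]
        ring)
    map_add' A B := by
      ext u v
      simp only [LinearMap.mk₂'ₛₗ_apply, LinearMap.add_apply, _root_.map_add, star_add, add_act,
        inner_add_left, inner_add_right, add_apply]
      ring
    map_smul' c A := by
      ext u v
      simp only [LinearMap.mk₂'ₛₗ_apply, LinearMap.smul_apply, map_smul, star_smul, smul_act,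
        inner_smul_left, inner_smul_right, smul_apply, RingHom.id_apply, smul_eq_mul,
        RCLike.star_def, Complex.conj_conj]
      ring }

variable {S} in
theorem inner_generator_eq_dissipation_add (hD : ∀ A ∈ S.domainAlgebra, A ∈ S.generator.domain)
    {w : H} (G : S.rankOneSubspace w →ₗ[ℂ] H) (A : S.domainAlgebra) (u v : S.rankOneSubspace w) :
    ⟪(u : H), S.generator ⟨(A : H →L[ℂ] H), hD _ A.2⟩ (v : H)⟫_ℂ
      = dissipation hD G A u v + ⟪(u : H), G (S.act A v)⟫_ℂ
        + ⟪G (S.act (star A) u), (v : H)⟫_ℂ := by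
  have h : dissipation hD G A u v
      = ⟪(u : H), S.generator ⟨(A : H →L[ℂ] H), hD _ A.2⟩ (v : H)⟫_ℂ
        - ⟪(u : H), G (S.act A v)⟫_ℂ - ⟪G (S.act (star A) u), (v : H)⟫_ℂ := rfl
  rw [h]
  ring

variable {S} in
theorem isUCompletelyPositive_dissipation
    (hD : ∀ A ∈ S.domainAlgebra, A ∈ S.generator.domain) {w h : H} (hw : ⟪w, h⟫_ℂ = 1)
    {c : ℂ} (hc : star c = c) (hW : rankOne ℂ w w ∈ S.generator.domain)
    (hcW : ⟪h, S.generator ⟨rankOne ℂ w w, hW⟩ h⟫_ℂ ≤ 2 * c) :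
    IsUCompletelyPositive S.domainAlgebra (S.rankOneSubspace w)
      (dissipation hD (drift hD w h c)) := by
  intro k A hA u
  let M : CStarMatrix (Fin k) (Fin k) (H →L[ℂ] H) :=
    CStarMatrix.ofMatrix (Matrix.of fun i j => (A i j : H →L[ℂ] H))
  have h1 := sum_inner_generator_nonneg (S := S) (M := M) hA (u := fun i => (u i : H)) hw
    (L := fun i j => generatorOnDomainAlgebra hD (A i j))
    (LR := fun i j => generatorOnDomainAlgebra hD (S.rankOneMap w (S.act (A i j) (u j))))
    (LR' := fun i j => generatorOnDomainAlgebra hD (S.rankOneMap w (S.act (star (A i j)) (u i))))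
    (fun i j => S.generator_spec ⟨A i j, hD _ (A i j).2⟩)
    (fun i j => S.generator_spec ⟨_, hD _ (S.rankOneMap w (S.act (A i j) (u j))).2⟩)
    (fun i j => S.generator_spec ⟨_, hD _ (S.rankOneMap w (S.act (star (A i j)) (u i))).2⟩)
    (S.generator_spec ⟨_, hW⟩)
  have h2 : 0 ≤ ∑ i, ∑ j, ⟪(u i : H), M i j (u j)⟫_ℂ := by
    obtain ⟨N, hN⟩ := exists_gram_of_nonneg (M := M) hA
    simp only [hN]
    exact sum_inner_gram_nonneg N fun i => (u i : H)
  -- The two `c`-terms of `G` contribute `2c ∑ ⟨uᵢ, Aᵢⱼ uⱼ⟩`; its excess over the term with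
  -- `L(|w⟩⟨w|)` is a product of nonnegative factors.
  refine (add_nonneg h1 (mul_nonneg h2 (sub_nonneg.mpr hcW))).trans_eq ?_
  rw [Finset.sum_mul, ← Finset.sum_add_distrib]
  refine Finset.sum_congr rfl fun i _ => ?_
  rw [Finset.sum_mul, ← Finset.sum_add_distrib]
  refine Finset.sum_congr rfl fun j _ => ?_
  have hadj : ⟪((S.act (star (A i j)) (u i) : S.rankOneSubspace w) : H), (u j : H)⟫_ℂ
      = ⟪(u i : H), M i j (u j)⟫_ℂ :=
    ContinuousLinearMap.adjoint_inner_left (A i j : H →L[ℂ] H) (u j : H) (u i : H)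
  have hφ : dissipation hD (drift hD w h c) (A i j) (u i) (u j)
      = ⟪(u i : H), generatorOnDomainAlgebra hD (A i j) (u j : H)⟫_ℂ
        - ⟪(u i : H), generatorOnDomainAlgebra hD (S.rankOneMap w (S.act (A i j) (u j))) h
            - c • (S.act (A i j) (u j) : H)⟫_ℂ
        - ⟪generatorOnDomainAlgebra hD (S.rankOneMap w (S.act (star (A i j)) (u i))) h
            - c • (S.act (star (A i j)) (u i) : H), (u j : H)⟫_ℂ := rfl
  have hM' : ((S.act (A i j) (u j) : S.rankOneSubspace w) : H) = M i j (u j) := rfl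
  have hc' : (starRingEnd ℂ) c = c := hc
  rw [hφ, inner_sub_right, inner_sub_left, inner_smul_right, inner_smul_left, hadj, hM', hc']
  ring

end QuantumMarkovSemigroup

end QMS

end

theorem theorem3p9 {H : Type*} [NormedAddCommGroup H] [InnerProductSpace ℂ H] [CompleteSpace H]
    (S : QMS.QuantumMarkovSemigroup H)
    (T : H →L[ℂ] H) (hTpos : T.IsPositive)
    (hTfin : FiniteDimensional ℂ (LinearMap.range (T : H →ₗ[ℂ] H))) (hT0 : T ≠ 0)
    (hT : T ∈ S.generator.domain)
    (h : H) (hh : QMS.IsAssociateVector T h)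
    (hTh : InnerProductSpace.rankOne ℂ (T h) (T h) ∈ S.generator.domain) :
    -- the domain algebra is the largest `*`-subalgebra of `D(L)`, and its explicit description
    IsGreatest S.starSubalgebrasInDomain S.domainAlgebra ∧
    (∀ A : H →L[ℂ] H, A ∈ S.domainAlgebra ↔ A ∈ S.generator.domain ∧
      star A * A ∈ S.generator.domain ∧ A * star A ∈ S.generator.domain) ∧
    -- the operator `G`, the map `φ` and the form of the generator
    ∃ (hD : ∀ A ∈ S.domainAlgebra, A ∈ S.generator.domain)
      (G : S.rankOneSubspace (T h) →ₗ[ℂ] H)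
      (φ : S.domainAlgebra →ₗ[ℂ]
        (S.rankOneSubspace (T h) →ₗ⋆[ℂ] S.rankOneSubspace (T h) →ₗ[ℂ] ℂ)),
      (∀ u : S.rankOneSubspace (T h),
        G u = S.generator ⟨InnerProductSpace.rankOne ℂ (u : H) (T h), hD _ u.2⟩ h
          - ((1 / 2 : ℂ) * ⟪h, S.generator ⟨T, hT⟩ h⟫_ℂ) • (u : H)) ∧
      QMS.IsUCompletelyPositive S.domainAlgebra (S.rankOneSubspace (T h)) φ ∧
      ∀ (A : S.domainAlgebra) (u v : S.rankOneSubspace (T h)),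
        ⟪(u : H), S.generator ⟨(A : H →L[ℂ] H), hD _ A.2⟩ (v : H)⟫_ℂ
          = φ A u v + ⟪(u : H), G (S.act A v)⟫_ℂ + ⟪G (S.act (star A) u), (v : H)⟫_ℂ := by
  have hw : ⟪T h, h⟫_ℂ = 1 := hh.inner_eq_one hT0
  have hstar : star T = T := hTpos.isSelfAdjoint
  have hD : ∀ A ∈ S.domainAlgebra, A ∈ S.generator.domain := S.isGreatest_domainAlgebra.1
  refine ⟨S.isGreatest_domainAlgebra, fun A => S.mem_domainAlgebra_iff, hD,
    QMS.QuantumMarkovSemigroup.drift hD (T h) h ((1 / 2 : ℂ) * ⟪h, S.generator ⟨T, hT⟩ h⟫_ℂ),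
    QMS.QuantumMarkovSemigroup.dissipation hD (QMS.QuantumMarkovSemigroup.drift hD (T h) h
      ((1 / 2 : ℂ) * ⟪h, S.generator ⟨T, hT⟩ h⟫_ℂ)), fun u => rfl,
    QMS.QuantumMarkovSemigroup.isUCompletelyPositive_dissipation hD hw ?_ hTh ?_,
    QMS.QuantumMarkovSemigroup.inner_generator_eq_dissipation_add hD _⟩
  · have hc := QMS.QuantumMarkovSemigroup.HasGenerator.inner_self_conj S
      (S.generator_spec ⟨T, hT⟩) hstar h
    have hc' : star ⟪h, S.generator ⟨T, hT⟩ h⟫_ℂ = ⟪h, S.generator ⟨T, hT⟩ h⟫_ℂ :=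
      (inner_conj_symm _ _).trans hc
    rw [star_mul, hc', mul_comm]
    simp
  -- `T - |T h⟩⟨T h|` is positive with zero expectation at `h`, so its image under the generator has
  -- nonnegative expectation there.
  · have hle := sub_nonneg.mpr (QMS.rankOne_le_of_inner_eq_one hTpos hw)
    have hgen := (S.generator_spec ⟨T, hT⟩).add S ((S.generator_spec ⟨_, hTh⟩).smul S (-1))
    simp only [neg_one_smul, ← sub_eq_add_neg] at hgen
    have hpos := QMS.QuantumMarkovSemigroup.HasGenerator.inner_self_nonneg S hgen hle (h := h)
      (by rw [sub_apply, inner_sub_right, InnerProductSpace.rankOne_apply, hw, one_smul, sub_self])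
    rw [sub_apply, inner_sub_right, sub_nonneg] at hpos
    refine hpos.trans_eq ?_
    ring
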